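/- Let $p$ be an odd prime, $n\ge 1$, $d=p^n$, $\omega=e^{2\pi i/p}$, $\tau=\omega^{(p+1)/2}$, and let $\mathrm{tr}:\mathbb F_d\to\mathbb Z_p$ be the field trace. Let $l$ be the quadratic character of $\mathbb F_d$ ($l(x)=1$ if $x$ is a nonzero square, $-1$ if $x$ is not a square, and $l(0)=0$), and put $\tilde l(x)=-i^{-n(p+3)/2}\,l(x)$ for $x\ne0$ and $\tilde l(0)=1$. On $\mathbb C^d$, with orthonormal basis $(|x\rangle)_{x\in\mathbb F_d}$, let $X_a|x\rangle=|x+a\rangle$, $Z_a|x\rangle=\omega^{\mathrm{tr}(xa)}|x\rangle$, and for $\mathbf u=(u_1,u_2)\in\mathbb F_d^2$ let $D_{\mathbf u}=\tau^{\mathrm{tr}(u_1u_2)}X_{u_1}Z_{u_2}$. Put $\langle\mathbf u,\mathbf v\rangle=\mathrm{tr}(u_2v_1-u_1v_2)$. For $F=\begin{pmatrix}\alpha&\beta\\\gamma&\delta\end{pmatrix}\in \mathrm{SL}(2,\mathbb F_d)$ define $$U_F=\begin{cases} l(\alpha)\sum_{x\in\mathbb F_d}\tau^{\mathrm{tr}(\alpha\gamma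 x^2)}|\alpha x\rangle\langle x| & \text{if }\beta=0,\\[4pt] \dfrac{\tilde l(-\beta)}{\sqrt d}\sum_{x,y\in\mathbb F_d}\tau^{\mathrm{tr}(\beta^{-1}(\alpha y^2-2xy+\delta x^2))}|x\rangle\langle y| & \text{if }\beta\neq0.\end{cases}$$ Let $t=\mathrm{Tr}(F)=\alpha+\delta$. Then: (a) If $t\ne2$, put $\tilde F=\frac1{2-t}F$; then $$U_F=\begin{cases}\dfrac{l(t-2)}{d}\sum_{\mathbf u\in\mathbb F_d^2}\tau^{\langle\mathbf u,\tilde F\mathbf u\rangle}D_{\mathbf u} & \text{if }\beta\ne0,\\[4pt] \dfrac{l(\alpha)}{d}\sum_{\mathbf u\in\mathbb F_d^2}\tau^{\langle\mathbf u,\tilde F\mathbf u\rangle}D_{\mathbf u} & \text{if }\beta=0.\end{cases}$$ (b) If $t=2$, then $$U_F=\begin{cases}\dfrac{\tilde l(-\beta)}{\sqrt d}\sum_{r\in\mathbb F_d}\tau^{\mathrm{tr}(\beta r^2)}D_{(\beta r,(1-\alpha)r)} & \text{if }\beta\ne0,\\[4pt] \dfrac{\tilde l(\gamma)}{\sqrt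 d}\sum_{r\in\mathbb F_d}\tau^{-\mathrm{tr}(\gamma r^2)}D_{(0,\gamma r)} & \text{if }\beta=0,\ \gamma\ne0,\\[4pt] D_{(0,0)} & \text{if }\beta=\gamma=0.\end{cases}$$ (c) If $t\ne2$, then $\mathrm{Tr}(U_F)=l(t-2)$ if $\beta\ne0$, and $\mathrm{Tr}(U_F)=l(\alpha)$ if $\beta=0$. (d) If $t=2$, then $\mathrm{Tr}(U_F)=\tilde l(-\beta)\sqrt d$ if $\beta\ne0$, $\mathrm{Tr}(U_F)=\tilde l(\gamma)\sqrt d$ if $\beta=0$ and $\gamma\neq0$, and $\mathrm{Tr}(U_F)=d$ if $\beta=\gamma=0$. -/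

import Mathlib

namespace GaloisClifford

/-- `ω = e^{2πi/p}`. -/
noncomputable def omega (p : ℕ) : ℂ := Complex.exp (2 * Real.pi * Complex.I / p)

/-- `τ = ω^{(p+1)/2}`; the division is exact for odd `p`. -/
noncomputable def tau (p : ℕ) : ℂ := omega p ^ ((p + 1) / 2)

/-- `ω^a` for `a ∈ ℤ_p`, through the representative of `a` in `{0, …, p - 1}`. -/
noncomputable def omegaPow (p : ℕ) (a : ZMod p) : ℂ := omega p ^ a.val

/-- `τ^a` for `a ∈ ℤ_p`, through the representative of `a` in `{0, …, p - 1}`. -/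
noncomputable def tauPow (p : ℕ) (a : ZMod p) : ℂ := tau p ^ a.val

/-- The quantity `l̃(x)`: `-i^{-n(p+3)/2} l(x)` for `x ≠ 0`, and `1` for `x = 0`,
where `l` is the quadratic character of the field. The division is exact for odd `p`. -/
noncomputable def lTilde {K : Type*} [Field K] [Fintype K] [DecidableEq K]
    (p n : ℕ) (x : K) : ℂ :=
  if x = 0 then 1
  else -Complex.I ^ (-((n * (p + 3) / 2 : ℕ) : ℤ)) * (quadraticChar K x : ℂ)

/-- `tr : 𝔽_d → ℤ_p`, the trace of the field over its prime field. -/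
noncomputable def tr (p : ℕ) {K : Type*} [Field K] [Algebra (ZMod p) K] (x : K) : ZMod p :=
  Algebra.trace (ZMod p) K x

/-- The symplectic form `⟨u, v⟩ = tr(u₂ v₁ - u₁ v₂)`. -/
noncomputable def sympForm (p : ℕ) {K : Type*} [Field K] [Algebra (ZMod p) K]
    (u v : Fin 2 → K) : ZMod p :=
  tr p (u 1 * v 0 - u 0 * v 1)

/-- The operator `|x⟩⟨y|`, as a matrix in the standard basis labelled by the field. -/
def ketBra {K : Type*} [DecidableEq K] (x y : K) : Matrix K K ℂ := Matrix.single x y 1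

/-- `X_u |x⟩ = |x + u⟩`. -/
def X {K : Type*} [Field K] [Fintype K] [DecidableEq K] (u : K) : Matrix K K ℂ :=
  ∑ x : K, ketBra (x + u) x

/-- `Z_u |x⟩ = ω^{tr(xu)} |x⟩`. -/
noncomputable def Z (p : ℕ) {K : Type*} [Field K] [Fintype K] [DecidableEq K]
    [Algebra (ZMod p) K] (u : K) : Matrix K K ℂ :=
  ∑ x : K, omegaPow p (tr p (x * u)) • ketBra x x

/-- The displacement operator `D_u = τ^{tr(u₁ u₂)} X_{u₁} Z_{u₂}`. -/
noncomputable def D (p : ℕ) {K : Type*} [Field K] [Fintype K] [DecidableEq K]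
    [Algebra (ZMod p) K] (u : Fin 2 → K) : Matrix K K ℂ :=
  tauPow p (tr p (u 0 * u 1)) • (X (u 0) * Z p (u 1))

/-- The symplectic unitary `U_F`, for `F = (α β; γ δ)` of determinant `1`. -/
noncomputable def U (p n : ℕ) {K : Type*} [Field K] [Fintype K] [DecidableEq K]
    [Algebra (ZMod p) K] (F : Matrix.SpecialLinearGroup (Fin 2) K) : Matrix K K ℂ :=
  let α := F 0 0
  let β := F 0 1
  let γ := F 1 0
  let δ := F 1 1
  if β = 0 then
    (quadraticChar K α : ℂ) •
      ∑ x : K, tauPow p (tr p (α * γ * x ^ 2)) • ketBra (α * x) x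
  else
    (lTilde p n (-β) / (Real.sqrt (Fintype.card K) : ℂ)) •
      ∑ x : K, ∑ y : K,
        tauPow p (tr p (β⁻¹ * (α * y ^ 2 - 2 * x * y + δ * x ^ 2))) • ketBra x y

end GaloisClifford

/-!
The entries of `D_u` and of `U_F` are values of the additive character `ψ(x) = τ^{tr x}`
(`trChar`): the entry `(a, b)` of `D_u` is `ψ((a + b) u₂)` if `u₁ = a - b` and `0` otherwise
(`D_apply`). Hence an entry of a sum of displacement operators is a sum over `𝔽_d` of `ψ` at a
polynomial of degree at most two. The sum is evaluated by completing the square (`sum_quadratic`)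
or, when the quadratic term vanishes, by orthogonality of characters (`sum_linear`), and compared
with the entry of `U_F`. The traces are sums of the same kind.

The comparison rests on the exact value of `G = ∑ x, ψ(x²)`, namely `G = -i^{-n(p+3)/2} √d`
(`sum_trChar_sq`), so that `l̃(x) = l(x) G / √d` for `x ≠ 0` (`lTilde_eq`). There are two parts.

* For `d = p` the sign has to be determined. With `q = τ⁻²`, the Gaussian binomial coefficients
  `[p - 1, j]_q` equal `(-1)^j τ^{j² + j}`, so up to the phase from completing the square, `G` is
  their alternating sum, which Gauss's product formula (`sum_neg_one_pow_mul_qBinom`) writes as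
  `∏ (1 - q^k)` over the odd `k < p`. Each factor is `2 sin(π k / p) > 0` times an explicit phase,
  which gives the argument of `G` (`exists_sum_tauChar_sq`). The modulus `√p` is Mathlib's
  evaluation of the square of a quadratic Gauss sum.
* For general `d`, diagonalizing the trace form `tr(x y)` over `ℤ_p` turns `G` into a product of
  `n` sums over `ℤ_p`, up to the quadratic character of the discriminant of the form
  (`sum_trChar_sq_eq_pow`). That discriminant is the square of the determinant of the matrix of
  Frobenius conjugates of a basis, on whose rows the Frobenius acts as an `n`-cycle; its quadratic
  character is therefore `(-1)^{n-1}` (`prod_quadraticChar_trace`).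
-/

namespace GaloisClifford

open Finset

/-! ### Gaussian binomial coefficients at a root of unity -/

/-- The Gaussian binomial coefficient `[m, j]_q`, as an element of an arbitrary commutative ring,
given by the `q`-Pascal rule. It vanishes for `j > m`. -/
def qBinom {R : Type*} [CommRing R] (q : R) : ℕ → ℕ → R
  | _, 0 => 1
  | 0, _ + 1 => 0
  | m + 1, j + 1 => qBinom q m j + q ^ (j + 1) * qBinom q m (j + 1)

section QBinom

variable {R : Type*} [CommRing R] (q : R)

@[simp] lemma qBinom_zero_right (m : ℕ) : qBinom q m 0 = 1 := by cases m <;> simp [qBinom]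

@[simp] lemma qBinom_zero_succ (j : ℕ) : qBinom q 0 (j + 1) = 0 := by simp [qBinom]

lemma qBinom_succ_succ (m j : ℕ) :
    qBinom q (m + 1) (j + 1) = qBinom q m j + q ^ (j + 1) * qBinom q m (j + 1) := by
  simp [qBinom]

lemma qBinom_eq_zero_of_lt {m j : ℕ} (h : m < j) : qBinom q m j = 0 := by
  induction m generalizing j with
  | zero => obtain ⟨j, rfl⟩ := Nat.exists_eq_succ_of_ne_zero h.ne'; simp
  | succ m ih =>
    obtain ⟨j, rfl⟩ := Nat.exists_eq_succ_of_ne_zero (Nat.ne_zero_of_lt h)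
    rw [Nat.succ_eq_add_one, qBinom_succ_succ, ih (by omega), ih (by omega)]
    ring

/-- The absorption identity `[j + 1] [m + 1, j + 1] = [m + 1] [m, j]`. -/
lemma one_sub_pow_mul_qBinom (m j : ℕ) :
    (1 - q ^ (j + 1)) * qBinom q (m + 1) (j + 1) = (1 - q ^ (m + 1)) * qBinom q m j := by
  induction m generalizing j with
  | zero => cases j <;> simp [qBinom_succ_succ]
  | succ m ih =>
    have h1 := ih j
    rw [qBinom_succ_succ q (m + 1) j]
    cases j with
    | zero =>
      simp only [qBinom_zero_right] at h1 ⊢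
      linear_combination q * h1
    | succ j =>
      linear_combination q ^ (j + 2) * h1 + q * ih j
        - q * (1 - q ^ (m + 1)) * qBinom_succ_succ q m j

/-- The three-term recursion satisfied by the Gaussian binomial coefficients, which is the
recursion of the Rogers–Szegő polynomials. -/
lemma qBinom_succ_succ_succ (m j : ℕ) :
    qBinom q (m + 2) (j + 1) =
      qBinom q (m + 1) j + qBinom q (m + 1) (j + 1) - (1 - q ^ (m + 1)) * qBinom q m j := by
  linear_combination qBinom_succ_succ q (m + 1) j - one_sub_pow_mul_qBinom q m j

/-- Gauss's product formula for an alternating sum of Gaussian binomial coefficients. -/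
lemma sum_neg_one_pow_mul_qBinom (h : ℕ) :
    ∑ j ∈ range (2 * h + 1), (-1) ^ j * qBinom q (2 * h) j =
      ∏ k ∈ range h, (1 - q ^ (2 * k + 1)) := by
  induction h with
  | zero => simp
  | succ h ih =>
    have e0 : ∑ j ∈ range (2 * h + 2), (-1) ^ j * qBinom q (2 * h) j =
        ∑ j ∈ range (2 * h + 1), (-1) ^ j * qBinom q (2 * h) j := by
      rw [sum_range_succ, qBinom_eq_zero_of_lt q (Nat.lt_succ_self _)]; simp
    have e1 : ∑ j ∈ range (2 * h + 2), (-1) ^ j * qBinom q (2 * h + 1) j =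
        1 - ∑ j ∈ range (2 * h + 2), (-1) ^ j * qBinom q (2 * h + 1) (j + 1) := by
      rw [sum_range_succ', sum_range_succ _ (2 * h + 1),
        qBinom_eq_zero_of_lt q (show 2 * h + 1 < 2 * h + 1 + 1 by omega)]
      simp [pow_succ]; ring
    rw [prod_range_succ, ← ih, ← e0, show 2 * (h + 1) = 2 * h + 2 by ring, sum_range_succ']
    have e2 : ∀ j, (-1 : R) ^ (j + 1) * qBinom q (2 * h + 2) (j + 1) =
        -((-1) ^ j * qBinom q (2 * h + 1) j) - (-1) ^ j * qBinom q (2 * h + 1) (j + 1) +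
          (1 - q ^ (2 * h + 1)) * ((-1) ^ j * qBinom q (2 * h) j) := fun j => by
      rw [qBinom_succ_succ_succ]; ring
    simp only [e2, sum_add_distrib, sum_sub_distrib, sum_neg_distrib, ← mul_sum]
    simp only [pow_zero, qBinom_zero_right, e1]
    ring

end QBinom

/-- At `q = s⁻²` a primitive root of unity of order `m + 1`, the Gaussian binomial coefficients
`[m, j]_q` are, up to sign, the terms of a quadratic exponential sum. -/
lemma qBinom_eq_pow_of_isPrimitiveRoot {F : Type*} [Field F] {q s : F} {m : ℕ}
    (hq : IsPrimitiveRoot q (m + 1)) (hqs : q * s ^ 2 = 1) {j : ℕ} (hj : j ≤ m) :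
    qBinom q m j = (-1) ^ j * s ^ (j * (j + 1)) := by
  induction j with
  | zero => simp
  | succ j ih =>
    have h1 := one_sub_pow_mul_qBinom q m j
    rw [hq.pow_eq_one, sub_self, zero_mul, mul_eq_zero, qBinom_succ_succ] at h1
    have h2 := h1.resolve_left (sub_ne_zero.2 (hq.pow_ne_one_of_pos_of_lt (by omega)
      (by omega)).symm)
    have h3 : q ^ (j + 1) * s ^ (2 * (j + 1)) = 1 := by
      rw [pow_mul, ← mul_pow, hqs, one_pow]
    rw [ih (by omega)] at h2
    rw [show (j + 1) * (j + 1 + 1) = j * (j + 1) + 2 * (j + 1) by ring, pow_add s, pow_succ]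
    linear_combination s ^ (2 * (j + 1)) * h2 - qBinom q m (j + 1) * h3

/-! ### Quadratic exponential sums over a finite field -/

section QuadraticSum

variable {F : Type*} [Field F] [Fintype F] [DecidableEq F]

lemma sum_sq_eq_gaussSum (hF : ringChar F ≠ 2) {ψ : AddChar F ℂ} (hψ : ψ ≠ 1) :
    ∑ x, ψ (x ^ 2) = gaussSum ((quadraticChar F).ringHomComp (Int.castRingHom ℂ)) ψ := by
  have h1 : ∀ a : F, ((univ.filter fun x : F => x ^ 2 = a).card : ℂ) =
      (quadraticChar F a : ℂ) + 1 := fun a => by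
    have := quadraticChar_card_sqrts hF a
    have e : {x : F | x ^ 2 = a}.toFinset = univ.filter fun x : F => x ^ 2 = a := by ext; simp
    rw [e] at this
    exact_mod_cast congrArg (Int.cast : ℤ → ℂ) this
  calc ∑ x, ψ (x ^ 2) = ∑ a, ∑ x with x ^ 2 = a, ψ (x ^ 2) := by
        rw [sum_fiberwise]
    _ = ∑ a, ((quadraticChar F a : ℂ) + 1) * ψ a := by
        refine sum_congr rfl fun a _ => ?_
        rw [← h1, ← nsmul_eq_mul, ← sum_const]
        exact sum_congr rfl fun x hx => by rw [(mem_filter.1 hx).2]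
    _ = _ := by
        simp only [add_mul, one_mul, sum_add_distrib, AddChar.sum_eq_zero_of_ne_one hψ, add_zero]
        rfl

lemma sum_mul_sq (hF : ringChar F ≠ 2) {ψ : AddChar F ℂ} (hψ : ψ ≠ 1) {a : F} (ha : a ≠ 0) :
    ∑ x, ψ (a * x ^ 2) = quadraticChar F a * ∑ x, ψ (x ^ 2) := by
  have h1 : ψ.mulShift a ≠ 1 := fun h => ha (by
    by_contra ha'
    exact (AddChar.IsPrimitive.of_ne_one hψ) ha' h)
  have h2 := sum_sq_eq_gaussSum hF h1
  simp only [AddChar.mulShift_apply] at h2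
  have h3 := gaussSum_mulShift_eq ((quadraticChar F).ringHomComp (Int.castRingHom ℂ)) ψ
    (Units.mk0 a ha)
  rw [Units.val_mk0] at h3
  rw [h2, h3, sum_sq_eq_gaussSum hF hψ, ((quadraticChar_isQuadratic F).comp _).inv]
  simp

lemma sum_linear {ψ : AddChar F ℂ} (hψ : ψ ≠ 1) (b : F) :
    ∑ x, ψ (b * x) = if b = 0 then (Fintype.card F : ℂ) else 0 := by
  have h := AddChar.sum_mulShift b (AddChar.IsPrimitive.of_ne_one hψ)
  simp only [mul_comm _ b] at h
  rw [h]
  push_cast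
  rfl

/-- The square is completed in a quadratic exponential sum. -/
lemma sum_quadratic (hF : ringChar F ≠ 2) {ψ : AddChar F ℂ} (hψ : ψ ≠ 1) {a : F} (ha : a ≠ 0)
    (b : F) :
    ∑ x, ψ (a * x ^ 2 + b * x) =
      quadraticChar F a * ψ (-(b ^ 2 / (4 * a))) * ∑ x, ψ (x ^ 2) := by
  have h2 : (2 : F) ≠ 0 := Ring.two_ne_zero hF
  rw [mul_right_comm, ← sum_mul_sq hF hψ ha, sum_mul]
  refine Fintype.sum_equiv (Equiv.addRight (b / (2 * a))) _ _ fun x => ?_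
  rw [← AddChar.map_add_eq_mul, Equiv.coe_addRight]
  congr 1
  rw [show (4 : F) = 2 * 2 by norm_num]
  field_simp
  ring

lemma sum_sq_sq (hF : ringChar F ≠ 2) {ψ : AddChar F ℂ} (hψ : ψ ≠ 1) :
    (∑ x, ψ (x ^ 2)) ^ 2 = quadraticChar F (-1) * Fintype.card F := by
  have h1 : (quadraticChar F).ringHomComp (Int.castRingHom ℂ) ≠ 1 := by
    intro h
    refine quadraticChar_ne_one hF ?_
    ext a
    have := congrArg (fun χ : MulChar F ℂ => χ a) h
    simp only [MulChar.ringHomComp_apply, MulChar.one_apply_coe] at this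
    simpa using this
  rw [sum_sq_eq_gaussSum hF hψ, gaussSum_sq h1 ((quadraticChar_isQuadratic F).comp _)
    (AddChar.IsPrimitive.of_ne_one hψ)]
  simp

lemma norm_sum_sq (hF : ringChar F ≠ 2) {ψ : AddChar F ℂ} (hψ : ψ ≠ 1) :
    ‖∑ x, ψ (x ^ 2)‖ = √(Fintype.card F) := by
  have h3 := congrArg norm (sum_sq_sq hF hψ)
  have h4 : ‖(quadraticChar F (-1) : ℂ)‖ = 1 := by
    rcases quadraticChar_dichotomy (neg_ne_zero.2 (one_ne_zero (α := F))) with h | h <;> simp [h]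
  rw [norm_pow, norm_mul, h4, one_mul, Complex.norm_natCast] at h3
  rw [← h3, Real.sqrt_sq (norm_nonneg _)]

end QuadraticSum

/-! ### The quadratic exponential sum over the prime field -/

lemma omega_isPrimitiveRoot {p : ℕ} (hp : p ≠ 0) : IsPrimitiveRoot (omega p) p :=
  Complex.isPrimitiveRoot_exp p hp

lemma tau_pow_self {p : ℕ} (hp : p ≠ 0) : tau p ^ p = 1 := by
  rw [tau, ← pow_mul, mul_comm, pow_mul, (omega_isPrimitiveRoot hp).pow_eq_one, one_pow]

lemma tau_sq {p : ℕ} (hp : Odd p) : tau p ^ 2 = omega p := by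
  obtain ⟨h, rfl⟩ := hp
  rw [tau, ← pow_mul, show (2 * h + 1 + 1) / 2 * 2 = (2 * h + 1) + 1 by omega, pow_succ,
    (omega_isPrimitiveRoot (by omega)).pow_eq_one, one_mul]

/-- The additive character `x ↦ τ^x` of `ℤ_p`. -/
noncomputable def tauChar (p : ℕ) [NeZero p] : AddChar (ZMod p) ℂ :=
  AddChar.zmodChar p (tau_pow_self (NeZero.ne p))

lemma tauChar_apply (p : ℕ) [NeZero p] (a : ZMod p) : tauChar p a = tauPow p a := rfl

lemma tauChar_natCast (p : ℕ) [NeZero p] (a : ℕ) : tauChar p (a : ZMod p) = tau p ^ a :=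
  AddChar.zmodChar_apply' _ a

lemma omegaPow_eq (p : ℕ) [NeZero p] (hp : Odd p) (a : ZMod p) :
    omegaPow p a = tauChar p (2 * a) := by
  rw [two_mul, AddChar.map_add_eq_mul, tauChar_apply, omegaPow, ← tau_sq hp, tauPow]
  ring

lemma tauChar_ne_one (p : ℕ) [Fact p.Prime] (hp : p ≠ 2) : tauChar p ≠ 1 := by
  intro h
  have h1 : tauChar p ((2 : ℕ) : ZMod p) = 1 := by rw [h]; simp
  rw [tauChar_natCast, tau_sq ((Fact.out : p.Prime).odd_of_ne_two hp)] at h1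
  exact (omega_isPrimitiveRoot (Fact.out : p.Prime).ne_zero).ne_one
    (Fact.out : p.Prime).one_lt h1

lemma one_sub_exp_neg (θ : ℝ) :
    1 - Complex.exp (-(θ * Complex.I)) ^ 2 =
      Complex.exp (-(θ * Complex.I)) * Complex.I * (2 * Real.sin θ : ℝ) := by
  have h1 : Complex.exp (-(θ * Complex.I)) * Complex.exp (θ * Complex.I) = 1 := by
    rw [← Complex.exp_add]; simp
  push_cast
  rw [Complex.sin, ← neg_mul] at *
  linear_combination -h1 - Complex.exp (-θ * Complex.I) *
    (Complex.exp (-θ * Complex.I) - Complex.exp (θ * Complex.I)) * Complex.I_sq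

/-- The argument of the quadratic exponential sum over `ℤ_p`, including its sign. The shift of
`j` by `(p - 1) / 2`, which represents `-1 / 2`, turns the sum of the terms `τ^{j² + j}` into the
sum of the terms `τ^{x²}`; the former is an alternating sum of Gaussian binomial coefficients, and
Gauss's product formula writes it as a product of sines of angles in `(0, π)`. -/
lemma exists_sum_tauChar_sq (h : ℕ) :
    ∃ c : ℝ, 0 < c ∧ ∑ x : ZMod (2 * h + 1), tauChar (2 * h + 1) (x ^ 2) =
      (-Complex.I) ^ h * c := by
  set p := 2 * h + 1 with hp
  have hpC : (p : ℂ) ≠ 0 := by exact_mod_cast (by omega : p ≠ 0)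
  have hp2 : (p : ℂ) = 2 * h + 1 := by rw [hp]; push_cast; ring
  set σ : ℂ := Complex.exp (-(Real.pi * Complex.I / p)) with hσ
  have hτσ : tau p * σ = -1 := by
    rw [tau, omega, hσ, ← Complex.exp_nat_mul, ← Complex.exp_add, ← Complex.exp_pi_mul_I,
      show (p + 1) / 2 = h + 1 by omega]
    congr 1
    push_cast
    field_simp
    rw [hp2]; ring
  have hq : σ ^ 2 = (omega p)⁻¹ := by
    rw [hσ, omega, ← Complex.exp_neg, ← Complex.exp_nat_mul]
    congr 1
    push_cast
    ring
  have hqs : σ ^ 2 * tau p ^ 2 = 1 := by linear_combination (tau p * σ - 1) * hτσ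
  have hprim : IsPrimitiveRoot (σ ^ 2) (2 * h + 1) := by
    rw [hq]; exact (omega_isPrimitiveRoot (by omega)).inv
  refine ⟨∏ k ∈ range h, (2 * Real.sin ((2 * k + 1 : ℕ) * (Real.pi / p))), ?_, ?_⟩
  · refine prod_pos fun k hk => mul_pos two_pos (Real.sin_pos_of_pos_of_lt_pi ?_ ?_)
    · have : (0 : ℝ) < p := by exact_mod_cast (by omega : 0 < p)
      have := Real.pi_pos
      positivity
    · have h0 : (0 : ℝ) < p := by exact_mod_cast (by omega : 0 < p)
      have hlt : ((2 * k + 1 : ℕ) : ℝ) < p := by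
        have := mem_range.1 hk
        exact_mod_cast (by omega : 2 * k + 1 < p)
      rw [mul_div_assoc', div_lt_iff₀ h0, mul_comm Real.pi]
      exact mul_lt_mul_of_pos_right hlt Real.pi_pos
  have h1 : ∑ j ∈ range p, tau p ^ (j * (j + 1)) =
      ∏ k ∈ range h, (1 - (σ ^ 2) ^ (2 * k + 1)) := by
    rw [← sum_neg_one_pow_mul_qBinom]
    refine sum_congr rfl fun j hj => ?_
    rw [qBinom_eq_pow_of_isPrimitiveRoot hprim hqs (Nat.lt_succ_iff.1 (mem_range.1 hj)),
      ← mul_assoc, ← mul_pow]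
    simp
  have h2 : ∑ x : ZMod p, tauChar p (x ^ 2) =
      tau p ^ (h ^ 2) * ∑ j ∈ range p, tau p ^ (j * (j + 1)) := by
    have e : ∑ x : ZMod p, tauChar p (x ^ 2) = ∑ x : ZMod p, tauChar p ((x - h) ^ 2) :=
      (Fintype.sum_equiv (Equiv.subRight (h : ZMod p)) _ _ fun x => rfl).symm
    have h0 : (2 * h + 1 : ZMod p) = 0 := by
      have := ZMod.natCast_self p
      rw [hp] at this ⊢
      exact_mod_cast this
    rw [e, mul_sum]
    refine sum_bij' (fun x _ => x.val) (fun j _ => (j : ZMod p))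
      (fun x _ => mem_range.2 (ZMod.val_lt x)) (fun _ _ => mem_univ _)
      (fun x _ => ZMod.natCast_zmod_val x)
      (fun j hj => ZMod.val_cast_of_lt (mem_range.1 hj)) fun x _ => ?_
    rw [← pow_add, ← tauChar_natCast]
    push_cast
    rw [ZMod.natCast_zmod_val]
    congr 1
    linear_combination -x * h0
  have h3 : ∀ k : ℕ, 1 - (σ ^ 2) ^ (2 * k + 1) =
      σ ^ (2 * k + 1) * (Complex.I *
        (2 * Real.sin ((2 * k + 1 : ℕ) * (Real.pi / p)) : ℝ)) := fun k => by
    have e : σ ^ (2 * k + 1) =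
        Complex.exp (-(((2 * k + 1 : ℕ) * (Real.pi / p) : ℝ) * Complex.I)) := by
      rw [hσ, ← Complex.exp_nat_mul]
      congr 1
      push_cast
      ring
    rw [← pow_mul, mul_comm 2, pow_mul, e, one_sub_exp_neg]
    ring
  have h4 : ∏ k ∈ range h, σ ^ (2 * k + 1) = σ ^ (h ^ 2) := by
    rw [prod_pow_eq_pow_sum]
    congr 1
    clear * -
    induction h with
    | zero => simp
    | succ h ih => rw [sum_range_succ, ih]; ring
  rw [h2, h1, prod_congr rfl fun k _ => h3 k, prod_mul_distrib, h4, prod_mul_distrib, prod_const,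
    card_range, ← mul_assoc, ← mul_pow, hτσ, neg_pow Complex.I, Complex.ofReal_prod,
    ← mul_assoc]
  congr 2
  rcases Nat.even_or_odd h with hh | hh
  · rw [hh.neg_one_pow, (hh.pow_of_ne_zero two_ne_zero).neg_one_pow]
  · rw [hh.neg_one_pow, hh.pow.neg_one_pow]

lemma ringChar_zmod_ne_two {p : ℕ} (hp : p ≠ 2) : ringChar (ZMod p) ≠ 2 := by
  rwa [ZMod.ringChar_zmod_n]

/-- Gauss's determination of the sign of the quadratic Gauss sum. -/
lemma sum_tauChar_sq (p : ℕ) [Fact p.Prime] (hp : p ≠ 2) :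
    ∑ x : ZMod p, tauChar p (x ^ 2) = (-Complex.I) ^ (p / 2) * √p := by
  have hn := norm_sum_sq (ringChar_zmod_ne_two hp) (tauChar_ne_one p hp)
  obtain ⟨h, hh⟩ := (Fact.out : p.Prime).odd_of_ne_two hp
  subst hh
  obtain ⟨c, hc, he⟩ := exists_sum_tauChar_sq h
  rw [show (2 * h + 1) / 2 = h by omega, he]
  rw [he] at hn
  simp only [norm_mul, norm_pow, norm_neg, Complex.norm_I, one_pow, one_mul, Complex.norm_real,
    Real.norm_of_nonneg hc.le, ZMod.card] at hn
  rw [hn]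

/-! ### The quadratic exponential sum over an extension of the prime field -/

lemma addChar_map_sum {ι A M : Type*} [AddCommMonoid A] [CommMonoid M] (ψ : AddChar A M)
    (s : Finset ι) (f : ι → A) : ψ (∑ i ∈ s, f i) = ∏ i ∈ s, ψ (f i) :=
  map_prod ψ.toMonoidHom (fun i => Multiplicative.ofAdd (f i)) s

/-- The additive character `x ↦ τ^{tr x}` of the field. -/
noncomputable def trChar (p : ℕ) [Fact p.Prime] (K : Type*) [Field K] [Algebra (ZMod p) K] :
    AddChar K ℂ :=
  (tauChar p).compAddMonoidHom (Algebra.trace (ZMod p) K).toAddMonoidHom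

lemma trChar_apply (p : ℕ) [Fact p.Prime] {K : Type*} [Field K] [Algebra (ZMod p) K] (x : K) :
    trChar p K x = tauPow p (tr p x) := rfl

section Extension

variable {K : Type*} [Field K] [Fintype K] (p : ℕ) [Fact p.Prime] [Algebra (ZMod p) K]

/-- The matrix `M` of the Frobenius conjugates `b_j ^ (p ^ i)` of a family `b`. When the family is
as long as the degree of the field, `Mᵀ * M` is the Gram matrix of the trace form. -/
def conjMatrix {m : ℕ} (b : Fin m → K) : Matrix (Fin m) (Fin m) K :=
  Matrix.of fun i j => b j ^ p ^ (i : ℕ)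

/-- The Frobenius permutes the rows of the matrix of conjugates cyclically. -/
lemma det_conjMatrix_pow {m : ℕ} (hm : Fintype.card K = p ^ m) (b : Fin m → K) :
    (conjMatrix p b).det ^ p = (-1) ^ (m - 1) * (conjMatrix p b).det := by
  have : CharP K p := charP_of_injective_algebraMap (algebraMap (ZMod p) K).injective p
  have e : (frobenius K p).mapMatrix (conjMatrix p b) =
      (conjMatrix p b).submatrix (finRotate m) id := by
    ext i j
    rcases m with _ | m
    · exact i.elim0
    simp only [conjMatrix, RingHom.mapMatrix_apply, Matrix.map_apply, Matrix.of_apply,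
      frobenius_def, Matrix.submatrix_apply, id, ← pow_mul, ← pow_succ, finRotate_apply]
    rcases eq_or_ne i (Fin.last m) with rfl | hi
    · simp [← hm, FiniteField.pow_card]
    · rw [Fin.val_add_one_of_lt (lt_of_le_of_ne (Fin.le_last _) hi)]
  rw [← frobenius_def, RingHom.map_det, e, Matrix.det_permute, sign_finRotate]
  simp

/-- The discriminant of the trace form of `𝔽_{p^m}` is a square in `ℤ_p` exactly for odd `m`,
because the Frobenius multiplies its square root by the sign of an `m`-cycle. -/
lemma prod_quadraticChar_trace {m : ℕ} (hp : p ≠ 2) (hm : Fintype.card K = p ^ m)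
    (b : Fin m → K) (hb : ∀ i j, i ≠ j → Algebra.trace (ZMod p) K (b i * b j) = 0)
    (hb0 : ∀ i, Algebra.trace (ZMod p) K (b i * b i) ≠ 0) :
    ∏ i, quadraticChar (ZMod p) (Algebra.trace (ZMod p) K (b i * b i)) = (-1) ^ (m - 1) := by
  have hfin : Module.finrank (ZMod p) K = m := by
    have h := Module.card_eq_pow_finrank (K := ZMod p) (V := K)
    rw [hm, ZMod.card] at h
    exact (Nat.pow_right_injective (Fact.out : p.Prime).two_le h).symm
  have h1 : (conjMatrix p b).transpose * conjMatrix p b =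
      Matrix.diagonal fun i => algebraMap (ZMod p) K (Algebra.trace (ZMod p) K (b i * b i)) := by
    ext i j
    have h2 : ((conjMatrix p b).transpose * conjMatrix p b) i j =
        algebraMap (ZMod p) K (Algebra.trace (ZMod p) K (b i * b j)) := by
      rw [FiniteField.algebraMap_trace_eq_sum_pow, hfin, Nat.card_zmod, Finset.sum_range,
        Matrix.mul_apply]
      exact sum_congr rfl fun k _ => (mul_pow _ _ _).symm
    rw [h2]
    rcases eq_or_ne i j with rfl | hij
    · rw [Matrix.diagonal_apply_eq]
    · rw [Matrix.diagonal_apply_ne _ hij, hb i j hij, map_zero]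
  have h2 := congrArg Matrix.det h1
  rw [Matrix.det_mul, Matrix.det_transpose, Matrix.det_diagonal, ← map_prod] at h2
  set a : ZMod p := ∏ i, Algebra.trace (ZMod p) K (b i * b i) with ha
  have ha0 : a ≠ 0 := prod_ne_zero_iff.2 fun i _ => hb0 i
  have hdet : (conjMatrix p b).det ≠ 0 := by
    intro h
    rw [h, zero_mul, eq_comm, map_eq_zero] at h2
    exact ha0 h2
  have h3 : (conjMatrix p b).det ^ (p - 1) = (-1) ^ (m - 1) := by
    refine mul_right_cancel₀ hdet ?_
    rw [← det_conjMatrix_pow p hm b, ← pow_succ, Nat.sub_add_cancel (Fact.out : p.Prime).one_le]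
  have hodd := (Fact.out : p.Prime).eq_two_or_odd.resolve_left hp
  -- By Euler's criterion, the quadratic character of `a = det ^ 2` is `det ^ (p - 1)`.
  have h4 : ((quadraticChar (ZMod p) a : ℤ) : K) = (((-1) ^ (m - 1) : ℤ) : K) := by
    push_cast
    rw [← map_intCast (algebraMap (ZMod p) K),
      quadraticChar_eq_pow_of_char_ne_two' (ringChar_zmod_ne_two hp), ZMod.card, map_pow, ← h2,
      ← sq, ← pow_mul, ← h3]
    congr 1
    omega
  have hK : (-1 : K) ≠ 1 := by
    have : CharP K p := charP_of_injective_algebraMap (algebraMap (ZMod p) K).injective p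
    exact Ring.neg_one_ne_one_of_char_ne_two (by rwa [ringChar.eq K p])
  rw [← map_prod, ← ha]
  rcases quadraticChar_dichotomy ha0 with h | h <;>
    rcases neg_one_pow_eq_or ℤ (m - 1) with h' | h' <;>
    rw [h, h'] at h4 ⊢
  · exact absurd (by simpa using h4.symm) hK
  · exact absurd (by simpa using h4) hK

lemma trChar_ne_one (hp : p ≠ 2) : trChar p K ≠ 1 := by
  intro h
  refine tauChar_ne_one p hp ?_
  ext a
  obtain ⟨x, rfl⟩ := Algebra.trace_surjective (ZMod p) K a
  exact congrArg (fun ψ : AddChar K ℂ => ψ x) h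

/-- The lift of the quadratic Gauss sum to an extension of degree `m`: the Hasse–Davenport relation
for the quadratic character, obtained by diagonalizing the trace form. -/
lemma sum_trChar_sq_eq_pow {m : ℕ} (hp : p ≠ 2) (hm : Fintype.card K = p ^ m) :
    ∑ x : K, trChar p K (x ^ 2) =
      (-1) ^ (m - 1) * (∑ x : ZMod p, tauChar p (x ^ 2)) ^ m := by
  have hfin : Module.finrank (ZMod p) K = m := by
    have h := Module.card_eq_pow_finrank (K := ZMod p) (V := K)
    rw [hm, ZMod.card] at h
    exact (Nat.pow_right_injective (Fact.out : p.Prime).two_le h).symm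
  have h2 : (2 : ZMod p) ≠ 0 := Ring.two_ne_zero (ringChar_zmod_ne_two hp)
  let _ : Invertible (2 : ZMod p) := invertibleOfNonzero h2
  obtain ⟨b', hb'⟩ := LinearMap.BilinForm.exists_orthogonal_basis
    (LinearMap.BilinForm.isSymm_iff.1 (Algebra.traceForm_isSymm (ZMod p) (S := K)))
  let b := b'.reindex (finCongr hfin)
  have hb : ∀ i j, i ≠ j → Algebra.trace (ZMod p) K (b i * b j) = 0 := fun i j hij => by
    have := hb' (i := (finCongr hfin).symm i) (j := (finCongr hfin).symm j) (by simpa using hij)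
    simpa [b, Function.onFun, Algebra.traceForm_apply] using this
  have hb0 : ∀ i, Algebra.trace (ZMod p) K (b i * b i) ≠ 0 := fun i h => by
    refine b.ne_zero i ((traceForm_nondegenerate (ZMod p) K).1 (b i) fun y => ?_)
    have e : Algebra.traceForm (ZMod p) K (b i) = 0 := b.ext fun j => by
      rcases eq_or_ne i j with rfl | hij
      · exact h
      · exact hb i j hij
    rw [e, LinearMap.zero_apply]
  have htr : ∀ c : Fin m → ZMod p, Algebra.trace (ZMod p) K ((∑ i, c i • b i) ^ 2) =
      ∑ i, Algebra.trace (ZMod p) K (b i * b i) * c i ^ 2 := fun c => by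
    rw [sq, sum_mul_sum, map_sum]
    refine sum_congr rfl fun i _ => ?_
    rw [map_sum, sum_eq_single i]
    · rw [smul_mul_smul_comm, map_smul, smul_eq_mul]; ring
    · intro j _ hj
      rw [smul_mul_smul_comm, map_smul, hb i j hj.symm, smul_zero]
    · simp
  calc ∑ x : K, trChar p K (x ^ 2)
      = ∑ c : Fin m → ZMod p, trChar p K ((∑ i, c i • b i) ^ 2) :=
        Fintype.sum_equiv b.equivFun.toEquiv _ _ fun x => by
          rw [LinearEquiv.coe_toEquiv, b.sum_equivFun]
    _ = ∑ c : Fin m → ZMod p,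
          ∏ i, tauChar p (Algebra.trace (ZMod p) K (b i * b i) * c i ^ 2) :=
        sum_congr rfl fun c _ => by
          rw [← addChar_map_sum, ← htr]; rfl
    _ = ∏ i, ∑ y : ZMod p, tauChar p (Algebra.trace (ZMod p) K (b i * b i) * y ^ 2) := by
        rw [prod_univ_sum, Fintype.piFinset_univ]
    _ = _ := by
        simp only [sum_mul_sq (ringChar_zmod_ne_two hp) (tauChar_ne_one p hp) (hb0 _)]
        rw [prod_mul_distrib, prod_const, card_univ, Fintype.card_fin, ← Int.cast_prod,
          prod_quadraticChar_trace p hp hm b hb hb0]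
        push_cast
        rfl

/-- The value of the quadratic exponential sum, with the phase occurring in `lTilde`. -/
lemma sum_trChar_sq {n : ℕ} (hp : p ≠ 2) (hn : Fintype.card K = p ^ n) :
    ∑ x : K, trChar p K (x ^ 2) =
      -Complex.I ^ (-((n * (p + 3) / 2 : ℕ) : ℤ)) * (√(Fintype.card K) : ℝ) := by
  have hn0 : n ≠ 0 := by
    rintro rfl
    exact (Fintype.one_lt_card (α := K)).ne' (by simpa using hn)
  obtain ⟨h, hh⟩ := (Fact.out : p.Prime).odd_of_ne_two hp
  have h1 : n * (p + 3) / 2 = (h + 2) * n := by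
    rw [show n * (p + 3) = (h + 2) * n * 2 by rw [hh]; ring, Nat.mul_div_cancel _ two_pos]
  have h2 : √(Fintype.card K : ℝ) = √p ^ n := by
    rw [hn, Nat.cast_pow, Real.sqrt_eq_iff_eq_sq (by positivity) (by positivity), ← pow_mul,
      mul_comm, pow_mul, Real.sq_sqrt (by positivity)]
  rw [sum_trChar_sq_eq_pow p hp hn, sum_tauChar_sq p hp, h1, h2, zpow_neg, zpow_natCast, ← inv_pow,
    Complex.inv_I, show p / 2 = h by omega, mul_pow, ← pow_mul, Complex.ofReal_pow, ← mul_assoc,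
    add_mul, pow_add, pow_mul (-Complex.I) 2, neg_sq, Complex.I_sq]
  obtain ⟨m, rfl⟩ := Nat.exists_eq_succ_of_ne_zero hn0
  rw [Nat.succ_eq_add_one, Nat.add_sub_cancel, pow_succ (-1 : ℂ)]
  ring

end Extension

/-! ### Matrix entries of the displacement operators and of the symplectic unitaries -/

lemma sum_smul_ketBra_apply {ι : Type*} [Fintype ι] [DecidableEq ι] (f : ι → ι) (c : ι → ℂ)
    (a b : ι) : (∑ x : ι, c x • ketBra (f x) x) a b = if f b = a then c b else 0 := by
  rw [Matrix.sum_apply, sum_eq_single b]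
  · simp [ketBra, Matrix.single_apply]
  · intro x _ hx
    simp [ketBra, hx]
  · simp

lemma sqrt_card_mul_sqrt_card (ι : Type*) [Fintype ι] :
    ((√(Fintype.card ι) : ℝ) : ℂ) * (√(Fintype.card ι) : ℝ) = Fintype.card ι := by
  rw [← Complex.ofReal_mul, Real.mul_self_sqrt (Nat.cast_nonneg _), Complex.ofReal_natCast]

lemma ringChar_ne_two_of_algebra {p : ℕ} [Fact p.Prime] {K : Type*} [Field K]
    [Algebra (ZMod p) K] (hp : p ≠ 2) : ringChar K ≠ 2 := by
  have : CharP K p := charP_of_injective_algebraMap (algebraMap (ZMod p) K).injective p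
  rwa [ringChar.eq K p]

lemma mul_sub_mul_eq_one {K : Type*} [Field K] (F : Matrix.SpecialLinearGroup (Fin 2) K) :
    F 0 0 * F 1 1 - F 0 1 * F 1 0 = 1 := by
  rw [← Matrix.det_fin_two, F.det_coe]

lemma X_mul_Z (p : ℕ) {K : Type*} [Field K] [Fintype K] [DecidableEq K] [Algebra (ZMod p) K]
    (u v : K) :
    X u * Z p v = ∑ x : K, omegaPow p (tr p (x * v)) • ketBra (x + u) x := by
  simp only [X, Z, sum_mul]
  refine sum_congr rfl fun x _ => ?_
  rw [mul_sum, sum_eq_single x]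
  · simp [ketBra]
  · intro y _ hy
    simp [ketBra, hy.symm]
  · simp

section Entries

variable {K : Type*} [Field K] [Fintype K] [DecidableEq K] (p : ℕ) [Fact p.Prime]
  [Algebra (ZMod p) K]

lemma D_apply (hp : p ≠ 2) (u : Fin 2 → K) (a b : K) :
    D p u a b = if u 0 = a - b then trChar p K ((a + b) * u 1) else 0 := by
  rw [D, X_mul_Z, Matrix.smul_apply, sum_smul_ketBra_apply (fun x => x + u 0), smul_eq_mul]
  simp only [eq_sub_iff_add_eq, add_comm b, mul_ite, mul_zero]
  split_ifs with h
  · have e : (a + b) * u 1 = u 0 * u 1 + 2 * (b * u 1) := by rw [← h]; ring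
    rw [omegaPow_eq p ((Fact.out : p.Prime).odd_of_ne_two hp), e, two_mul, two_mul,
      AddChar.map_add_eq_mul, AddChar.map_add_eq_mul, AddChar.map_add_eq_mul]
    rfl
  · rfl

lemma U_apply_of_eq_zero (n : ℕ) (F : Matrix.SpecialLinearGroup (Fin 2) K) (h : F 0 1 = 0)
    (a b : K) :
    U p n F a b = quadraticChar K (F 0 0) *
      if F 0 0 * b = a then trChar p K (F 0 0 * F 1 0 * b ^ 2) else 0 := by
  rw [U, if_pos h, Matrix.smul_apply,
    sum_smul_ketBra_apply (fun x => F 0 0 * x)]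
  rfl

/-- Away from zero, `lTilde` differs from the quadratic character by the normalized quadratic
exponential sum. -/
lemma lTilde_eq {n : ℕ} (hp : p ≠ 2) (hn : Fintype.card K = p ^ n) {x : K} (hx : x ≠ 0) :
    lTilde p n x = quadraticChar K x * (∑ y : K, trChar p K (y ^ 2)) / √(Fintype.card K) := by
  have h : ((√(Fintype.card K) : ℝ) : ℂ) ≠ 0 := by
    rw [Complex.ofReal_ne_zero, Real.sqrt_ne_zero']
    exact_mod_cast Fintype.card_pos
  rw [lTilde, if_neg hx, sum_trChar_sq p hp hn, eq_div_iff h]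
  ring

lemma lTilde_div_sqrt {n : ℕ} (hp : p ≠ 2) (hn : Fintype.card K = p ^ n) {x : K} (hx : x ≠ 0) :
    lTilde p n x / (√(Fintype.card K) : ℝ) =
      quadraticChar K x * (∑ y : K, trChar p K (y ^ 2)) / Fintype.card K := by
  rw [lTilde_eq p hp hn hx, div_div, sqrt_card_mul_sqrt_card K]

lemma lTilde_mul_sqrt {n : ℕ} (hp : p ≠ 2) (hn : Fintype.card K = p ^ n) {x : K} (hx : x ≠ 0) :
    lTilde p n x * (√(Fintype.card K) : ℝ) =
      quadraticChar K x * ∑ y : K, trChar p K (y ^ 2) := by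
  have h : ((√(Fintype.card K) : ℝ) : ℂ) ≠ 0 := by
    rw [Complex.ofReal_ne_zero, Real.sqrt_ne_zero']
    exact_mod_cast Fintype.card_pos
  rw [lTilde_eq p hp hn hx, div_mul_cancel₀ _ h]

lemma U_apply_of_ne_zero {n : ℕ} (hp : p ≠ 2) (hn : Fintype.card K = p ^ n)
    (F : Matrix.SpecialLinearGroup (Fin 2) K) (h : F 0 1 ≠ 0) (a b : K) :
    U p n F a b = quadraticChar K (-F 0 1) * (∑ y : K, trChar p K (y ^ 2)) / Fintype.card K *
      trChar p K ((F 0 1)⁻¹ * (F 0 0 * b ^ 2 - 2 * a * b + F 1 1 * a ^ 2)) := by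
  rw [U, if_neg h, Matrix.smul_apply, lTilde_div_sqrt p hp hn (neg_ne_zero.2 h), smul_eq_mul]
  congr 1
  rw [Matrix.sum_apply, sum_eq_single a]
  · rw [sum_smul_ketBra_apply (fun _ => a), if_pos rfl]
    rfl
  · intro x _ hx
    rw [sum_smul_ketBra_apply (fun _ => x), if_neg hx]
  · simp

/-- The entry `(a, b)` of `D_u` vanishes unless `u₁ = a - b`, so that the sum over the phase space
reduces to a quadratic exponential sum in one variable. -/
lemma sum_smul_D_apply (hp : p ≠ 2) (M : Matrix (Fin 2) (Fin 2) K) (a b : K) :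
    (∑ u : Fin 2 → K, tauPow p (sympForm p u (M.mulVec u)) • D p u) a b =
      trChar p K (-(M 1 0 * (a - b) ^ 2)) * ∑ y : K, trChar p K
        (M 0 1 * y ^ 2 + ((M 0 0 - M 1 1) * (a - b) + (a + b)) * y) := by
  rw [Matrix.sum_apply, ← (finTwoArrowEquiv K).symm.sum_comp, Fintype.sum_prod_type,
    sum_eq_single (a - b), mul_sum]
  · refine sum_congr rfl fun y _ => ?_
    rw [Matrix.smul_apply, D_apply p hp, if_pos (by simp), sympForm, ← trChar_apply, smul_eq_mul,
      ← AddChar.map_add_eq_mul, ← AddChar.map_add_eq_mul]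
    congr 1
    simp [Matrix.mulVec, dotProduct, Fin.sum_univ_two]
    ring
  · intro x _ hx
    refine sum_eq_zero fun y _ => ?_
    rw [Matrix.smul_apply, D_apply p hp, if_neg (by simpa using hx), smul_zero]
  · simp

end Entries

/-! ### Expansions and traces -/

section Expansion

variable {K : Type*} [Field K] [Fintype K] [DecidableEq K] (p : ℕ) [Fact p.Prime]
  [Algebra (ZMod p) K]

lemma U_eq_sum_D {n : ℕ} (hp : p ≠ 2) (hn : Fintype.card K = p ^ n)
    (F : Matrix.SpecialLinearGroup (Fin 2) K) {t : K} (ht : t = F 0 0 + F 1 1) (ht2 : t ≠ 2)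
    (h : F 0 1 ≠ 0) :
    U p n F = ((quadraticChar K (t - 2) : ℂ) / (Fintype.card K : ℂ)) •
      ∑ u : Fin 2 → K, tauPow p (sympForm p u
        (((1 / (2 - t)) • (F : Matrix (Fin 2) (Fin 2) K)).mulVec u)) • D p u := by
  have hF := ringChar_ne_two_of_algebra (K := K) hp
  have hdet := mul_sub_mul_eq_one F
  have ht' : 2 - t ≠ 0 := sub_ne_zero.2 ht2.symm
  have h2 : (2 : K) ≠ 0 := Ring.two_ne_zero hF
  have hl : (quadraticChar K (-F 0 1) : ℂ) =
      quadraticChar K (t - 2) * quadraticChar K (1 / (2 - t) * F 0 1) := by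
    rw [← Int.cast_mul, ← map_mul]
    congr 2
    field_simp
    ring
  ext a b
  rw [U_apply_of_ne_zero p hp hn F h, Matrix.smul_apply, sum_smul_D_apply p hp]
  simp only [Matrix.smul_apply, smul_eq_mul]
  -- The coefficient of the square is `β / (2 - t)`, and its character value combines with
  -- `l(t - 2)` to `l(-β)`.
  rw [sum_quadratic hF (trChar_ne_one p hp) (mul_ne_zero (one_div_ne_zero ht') h), hl]
  have e : (F 0 1)⁻¹ * (F 0 0 * b ^ 2 - 2 * a * b + F 1 1 * a ^ 2) =
      -(1 / (2 - t) * F 1 0 * (a - b) ^ 2) +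
        -(((1 / (2 - t) * F 0 0 - 1 / (2 - t) * F 1 1) * (a - b) + (a + b)) ^ 2 /
          (4 * (1 / (2 - t) * F 0 1))) := by
    rw [show (4 : K) = 2 * 2 by norm_num]
    field_simp
    subst ht
    linear_combination (-4 * (a - b) ^ 2) * hdet
  rw [e, AddChar.map_add_eq_mul]
  ring

lemma U_eq_sum_D_of_eq_zero (n : ℕ) (hp : p ≠ 2)
    (F : Matrix.SpecialLinearGroup (Fin 2) K) {t : K} (ht : t = F 0 0 + F 1 1) (ht2 : t ≠ 2)
    (h : F 0 1 = 0) :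
    U p n F = ((quadraticChar K (F 0 0) : ℂ) / (Fintype.card K : ℂ)) •
      ∑ u : Fin 2 → K, tauPow p (sympForm p u
        (((1 / (2 - t)) • (F : Matrix (Fin 2) (Fin 2) K)).mulVec u)) • D p u := by
  have hdet := mul_sub_mul_eq_one F
  rw [h, zero_mul, sub_zero] at hdet
  have ht' : 2 - t ≠ 0 := sub_ne_zero.2 ht2.symm
  have h2 : (2 : K) ≠ 0 := Ring.two_ne_zero (ringChar_ne_two_of_algebra hp)
  have hα : F 0 0 ≠ 0 := left_ne_zero_of_mul_eq_one hdet
  have hδ : F 1 1 = (F 0 0)⁻¹ := eq_inv_of_mul_eq_one_right hdet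
  have hα1 : F 0 0 - 1 ≠ 0 := fun h1 => by
    rw [sub_eq_zero] at h1
    rw [h1, inv_one] at hδ
    exact ht2 (by rw [ht, h1, hδ]; norm_num)
  have hd : (Fintype.card K : ℂ) ≠ 0 := by exact_mod_cast Fintype.card_ne_zero
  ext a b
  rw [U_apply_of_eq_zero p n F h, Matrix.smul_apply, sum_smul_D_apply p hp]
  simp only [Matrix.smul_apply, smul_eq_mul, h, mul_zero, zero_mul, zero_add]
  -- For `β = 0` the exponent is linear in the summation variable, with coefficient `B`, and the sum
  -- vanishes unless `a = α b`.
  set B := (1 / (2 - t) * F 0 0 - 1 / (2 - t) * F 1 1) * (a - b) + (a + b) with hB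
  have hB' : (2 - t) * F 0 0 * B = 2 * (F 0 0 - 1) * (a - F 0 0 * b) := by
    rw [hB]
    field_simp
    subst ht
    linear_combination (-2 * a) * hdet
  have hiff : B = 0 ↔ F 0 0 * b = a := by
    rw [← mul_right_inj' (mul_ne_zero ht' hα), hB', mul_zero, mul_eq_zero, sub_eq_zero,
      or_iff_right (mul_ne_zero h2 hα1), eq_comm]
  rw [sum_linear (trChar_ne_one p hp), if_congr hiff rfl rfl]
  split_ifs with hab
  · have e : F 0 0 * F 1 0 * b ^ 2 = -(1 / (2 - t) * F 1 0 * (a - b) ^ 2) := by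
      rw [← hab]
      field_simp
      subst ht
      linear_combination (-F 1 0 * b ^ 2) * hdet
    rw [e]
    field_simp
  · simp

lemma U_eq_sum_D_of_trace_eq_two {n : ℕ} (hp : p ≠ 2) (hn : Fintype.card K = p ^ n)
    (F : Matrix.SpecialLinearGroup (Fin 2) K) (ht : F 0 0 + F 1 1 = 2) (h : F 0 1 ≠ 0) :
    U p n F = (lTilde p n (-F 0 1) / (√(Fintype.card K) : ℂ)) •
      ∑ r : K, tauPow p (tr p (F 0 1 * r ^ 2)) • D p ![F 0 1 * r, (1 - F 0 0) * r] := by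
  ext a b
  rw [U_apply_of_ne_zero p hp hn F h, lTilde_div_sqrt p hp hn (neg_ne_zero.2 h),
    Matrix.smul_apply, smul_eq_mul]
  congr 1
  rw [Matrix.sum_apply, sum_eq_single ((a - b) / F 0 1)]
  · rw [Matrix.smul_apply, D_apply p hp, if_pos (by simp [mul_div_cancel₀ _ h]), ← trChar_apply,
      smul_eq_mul, ← AddChar.map_add_eq_mul]
    congr 1
    rw [show F 1 1 = 2 - F 0 0 by linear_combination ht]
    simp only [Matrix.cons_val_one, Matrix.cons_val_fin_one]
    field_simp
    ring
  · intro r _ hr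
    rw [Matrix.smul_apply, D_apply p hp, if_neg, smul_zero]
    intro h'
    exact hr (by rw [eq_div_iff h, mul_comm]; simpa using h')
  · simp

lemma U_eq_sum_D_of_lower_unipotent {n : ℕ} (hp : p ≠ 2) (hn : Fintype.card K = p ^ n)
    (F : Matrix.SpecialLinearGroup (Fin 2) K) (hα : F 0 0 = 1) (h : F 0 1 = 0)
    (hγ : F 1 0 ≠ 0) :
    U p n F = (lTilde p n (F 1 0) / (√(Fintype.card K) : ℂ)) •
      ∑ r : K, tauPow p (-tr p (F 1 0 * r ^ 2)) • D p ![0, F 1 0 * r] := by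
  have hF := ringChar_ne_two_of_algebra (K := K) hp
  have hd : (Fintype.card K : ℂ) ≠ 0 := by exact_mod_cast Fintype.card_ne_zero
  ext a b
  rw [U_apply_of_eq_zero p n F h, lTilde_div_sqrt p hp hn hγ, Matrix.smul_apply, Matrix.sum_apply,
    hα, one_mul, one_mul, MulChar.map_one, Int.cast_one, one_mul]
  simp only [Matrix.smul_apply, D_apply p hp, smul_eq_mul, Matrix.cons_val_zero,
    Matrix.cons_val_one, Matrix.cons_val_fin_one]
  split_ifs with h1 h2 h2
  · subst h1
    have e : ∀ r : K, tauPow p (-tr p (F 1 0 * r ^ 2)) * trChar p K ((b + b) * (F 1 0 * r)) =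
        trChar p K (-F 1 0 * r ^ 2 + 2 * F 1 0 * b * r) := fun r => by
      rw [AddChar.map_add_eq_mul, trChar_apply p (-F 1 0 * r ^ 2), neg_mul, tr, tr, map_neg]
      congr 2
      ring
    have hγ2 := quadraticChar_sq_one hγ
    have h1 := sum_sq_sq hF (trChar_ne_one (K := K) p hp)
    have h3 := quadraticChar_sq_one (neg_ne_zero.2 (one_ne_zero (α := K)))
    have hsq : F 1 0 * b ^ 2 = -((2 * F 1 0 * b) ^ 2 / (4 * -F 1 0)) := by
      have h2 : (2 : K) ≠ 0 := Ring.two_ne_zero hF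
      rw [show (4 : K) = 2 * 2 by norm_num]
      field_simp
    have hneg : (quadraticChar K (-F 1 0) : ℂ) =
        quadraticChar K (-1) * quadraticChar K (F 1 0) := by
      rw [← Int.cast_mul, ← map_mul, neg_one_mul]
    simp only [e]
    rw [sum_quadratic hF (trChar_ne_one p hp) (neg_ne_zero.2 hγ), ← hsq, hneg]
    have hγ2' : (quadraticChar K (F 1 0) : ℂ) ^ 2 = 1 := by exact_mod_cast hγ2
    have h3' : (quadraticChar K (-1) : ℂ) ^ 2 = 1 := by exact_mod_cast h3
    field_simp
    linear_combination trChar p K (F 1 0 * b ^ 2) *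
      ((-quadraticChar K (-1) * (∑ y : K, trChar p K (y ^ 2)) ^ 2) * hγ2'
        - quadraticChar K (-1) * h1 - Fintype.card K * h3')
  · exact absurd h1 (by rw [eq_comm, sub_eq_zero] at h2; exact fun h => h2 h.symm)
  · exact absurd (sub_eq_zero.1 h2.symm).symm h1
  · simp

lemma U_eq_D_zero (n : ℕ) (hp : p ≠ 2) (F : Matrix.SpecialLinearGroup (Fin 2) K)
    (hα : F 0 0 = 1) (h : F 0 1 = 0) (hγ : F 1 0 = 0) : U p n F = D p 0 := by
  ext a b
  rw [U_apply_of_eq_zero p n F h, D_apply p hp, hα, hγ]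
  simp [eq_comm, sub_eq_zero]

lemma trace_U_of_ne_zero {n : ℕ} (hp : p ≠ 2) (hn : Fintype.card K = p ^ n)
    (F : Matrix.SpecialLinearGroup (Fin 2) K) (h : F 0 1 ≠ 0) :
    (U p n F).trace = quadraticChar K (-F 0 1) * (∑ y : K, trChar p K (y ^ 2)) /
      Fintype.card K * ∑ x : K, trChar p K ((F 0 1)⁻¹ * (F 0 0 + F 1 1 - 2) * x ^ 2) := by
  rw [Matrix.trace, mul_sum]
  refine sum_congr rfl fun x _ => ?_
  rw [Matrix.diag_apply, U_apply_of_ne_zero p hp hn F h]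
  congr 2
  ring

lemma trace_U_of_trace_ne_two {n : ℕ} (hp : p ≠ 2) (hn : Fintype.card K = p ^ n)
    (F : Matrix.SpecialLinearGroup (Fin 2) K) {t : K} (ht : t = F 0 0 + F 1 1) (ht2 : t ≠ 2)
    (h : F 0 1 ≠ 0) : (U p n F).trace = quadraticChar K (t - 2) := by
  have hF := ringChar_ne_two_of_algebra (K := K) hp
  have hd : (Fintype.card K : ℂ) ≠ 0 := by exact_mod_cast Fintype.card_ne_zero
  have h1 := sum_sq_sq hF (trChar_ne_one (K := K) p hp)
  have hl : quadraticChar K (-F 0 1) * quadraticChar K ((F 0 1)⁻¹ * (t - 2)) *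
      quadraticChar K (-1) = quadraticChar K (t - 2) := by
    rw [← map_mul, ← map_mul]
    congr 1
    field_simp
  have hl' : (quadraticChar K (-F 0 1) * quadraticChar K ((F 0 1)⁻¹ * (t - 2)) *
      quadraticChar K (-1) : ℂ) = quadraticChar K (t - 2) := by exact_mod_cast hl
  rw [trace_U_of_ne_zero p hp hn F h, ← ht, sum_mul_sq hF (trChar_ne_one p hp)
    (mul_ne_zero (inv_ne_zero h) (sub_ne_zero.2 ht2)), ← hl', div_mul_eq_mul_div,
    div_eq_iff hd]
  linear_combination (quadraticChar K (-F 0 1) * quadraticChar K ((F 0 1)⁻¹ * (t - 2)) : ℂ) * h1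

lemma trace_U_of_trace_eq_two {n : ℕ} (hp : p ≠ 2) (hn : Fintype.card K = p ^ n)
    (F : Matrix.SpecialLinearGroup (Fin 2) K) (ht : F 0 0 + F 1 1 = 2) (h : F 0 1 ≠ 0) :
    (U p n F).trace = lTilde p n (-F 0 1) * (√(Fintype.card K) : ℂ) := by
  have hd : (Fintype.card K : ℂ) ≠ 0 := by exact_mod_cast Fintype.card_ne_zero
  rw [trace_U_of_ne_zero p hp hn F h, lTilde_mul_sqrt p hp hn (neg_ne_zero.2 h), ht]
  simp [hd]

lemma trace_U_of_eq_zero (n : ℕ) (F : Matrix.SpecialLinearGroup (Fin 2) K)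
    (hα : F 0 0 ≠ 1) (h : F 0 1 = 0) : (U p n F).trace = quadraticChar K (F 0 0) := by
  rw [Matrix.trace, sum_eq_single 0]
  · simp [U_apply_of_eq_zero p n F h]
  · intro x _ hx
    rw [Matrix.diag_apply, U_apply_of_eq_zero p n F h, if_neg (by simp [hα, hx]), mul_zero]
  · simp

lemma trace_U_of_lower_unipotent (n : ℕ) (F : Matrix.SpecialLinearGroup (Fin 2) K)
    (hα : F 0 0 = 1) (h : F 0 1 = 0) :
    (U p n F).trace = ∑ x : K, trChar p K (F 1 0 * x ^ 2) := by
  refine sum_congr rfl fun x _ => ?_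
  rw [Matrix.diag_apply, U_apply_of_eq_zero p n F h, hα]
  simp

end Expansion

end GaloisClifford

theorem mainTheorem2 {K : Type*} [Field K] [Fintype K] [DecidableEq K]
    (p n : ℕ) [Fact p.Prime] (hp : p ≠ 2) [Algebra (ZMod p) K]
    (hd : Fintype.card K = p ^ n)
    (F : Matrix.SpecialLinearGroup (Fin 2) K) (α β γ δ t : K)
    (hF : (F : Matrix (Fin 2) (Fin 2) K) = !![α, β; γ, δ])
    (ht : t = Matrix.trace (F : Matrix (Fin 2) (Fin 2) K)) :
    -- the expansion in displacement operators, trace different from 2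
    (t ≠ 2 → β ≠ 0 →
      GaloisClifford.U p n F =
        ((quadraticChar K (t - 2) : ℂ) / (Fintype.card K : ℂ)) •
          ∑ u : Fin 2 → K,
            GaloisClifford.tauPow p (GaloisClifford.sympForm p u
              (((1 / (2 - t)) • (F : Matrix (Fin 2) (Fin 2) K)).mulVec u)) •
              GaloisClifford.D p u) ∧
    (t ≠ 2 → β = 0 →
      GaloisClifford.U p n F =
        ((quadraticChar K α : ℂ) / (Fintype.card K : ℂ)) •
          ∑ u : Fin 2 → K,
            GaloisClifford.tauPow p (GaloisClifford.sympForm p u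
              (((1 / (2 - t)) • (F : Matrix (Fin 2) (Fin 2) K)).mulVec u)) •
              GaloisClifford.D p u) ∧
    -- the expansion in displacement operators, trace equal to 2
    (t = 2 → β ≠ 0 →
      GaloisClifford.U p n F =
        (GaloisClifford.lTilde p n (-β) / (Real.sqrt (Fintype.card K) : ℂ)) •
          ∑ r : K, GaloisClifford.tauPow p (GaloisClifford.tr p (β * r ^ 2)) •
            GaloisClifford.D p ![β * r, (1 - α) * r]) ∧
    (t = 2 → β = 0 → γ ≠ 0 →
      GaloisClifford.U p n F =
        (GaloisClifford.lTilde p n γ / (Real.sqrt (Fintype.card K) : ℂ)) •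
          ∑ r : K, GaloisClifford.tauPow p (-GaloisClifford.tr p (γ * r ^ 2)) •
            GaloisClifford.D p ![0, γ * r]) ∧
    (t = 2 → β = 0 → γ = 0 →
      GaloisClifford.U p n F = GaloisClifford.D p 0) ∧
    -- the operator trace, for trace of F different from 2
    (t ≠ 2 → β ≠ 0 →
      Matrix.trace (GaloisClifford.U p n F) = (quadraticChar K (t - 2) : ℂ)) ∧
    (t ≠ 2 → β = 0 →
      Matrix.trace (GaloisClifford.U p n F) = (quadraticChar K α : ℂ)) ∧
    -- the operator trace, for trace of F equal to 2
    (t = 2 → β ≠ 0 →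
      Matrix.trace (GaloisClifford.U p n F) =
        GaloisClifford.lTilde p n (-β) * (Real.sqrt (Fintype.card K) : ℂ)) ∧
    (t = 2 → β = 0 → γ ≠ 0 →
      Matrix.trace (GaloisClifford.U p n F) =
        GaloisClifford.lTilde p n γ * (Real.sqrt (Fintype.card K) : ℂ)) ∧
    (t = 2 → β = 0 → γ = 0 →
      Matrix.trace (GaloisClifford.U p n F) = (Fintype.card K : ℂ)) := by
  have hα : F 0 0 = α := by rw [hF]; rfl
  have hβ : F 0 1 = β := by rw [hF]; rfl
  have hγ : F 1 0 = γ := by rw [hF]; rfl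
  have ht' : t = F 0 0 + F 1 1 := by rw [ht, Matrix.trace_fin_two]
  subst hα hβ hγ
  have hone : t = 2 → F 0 1 = 0 → F 0 0 = 1 := fun h2 h0 => by
    have hdet := GaloisClifford.mul_sub_mul_eq_one F
    have : (F 0 0 - 1) ^ 2 = 0 := by
      linear_combination -hdet - F 1 0 * h0 + F 0 0 * (h2 - ht')
    exact sub_eq_zero.1 (pow_eq_zero_iff two_ne_zero |>.1 this)
  have hne : t ≠ 2 → F 0 1 = 0 → F 0 0 ≠ 1 := fun h2 h0 h1 => by
    have hdet := GaloisClifford.mul_sub_mul_eq_one F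
    rw [h0, h1, zero_mul, sub_zero, one_mul] at hdet
    exact h2 (by rw [ht', h1, hdet]; norm_num)
  refine ⟨GaloisClifford.U_eq_sum_D p hp hd F ht', GaloisClifford.U_eq_sum_D_of_eq_zero p n hp F ht',
    fun h2 => GaloisClifford.U_eq_sum_D_of_trace_eq_two p hp hd F (ht'.symm.trans h2),
    fun h2 h0 => GaloisClifford.U_eq_sum_D_of_lower_unipotent p hp hd F (hone h2 h0) h0,
    fun h2 h0 => GaloisClifford.U_eq_D_zero p n hp F (hone h2 h0) h0,
    GaloisClifford.trace_U_of_trace_ne_two p hp hd F ht',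
    fun h2 h0 => GaloisClifford.trace_U_of_eq_zero p n F (hne h2 h0) h0,
    fun h2 => GaloisClifford.trace_U_of_trace_eq_two p hp hd F (ht'.symm.trans h2),
    fun h2 h0 hc => ?_, fun h2 h0 hc => ?_⟩
  · rw [GaloisClifford.trace_U_of_lower_unipotent p n F (hone h2 h0) h0,
      GaloisClifford.lTilde_mul_sqrt p hp hd hc,
      GaloisClifford.sum_mul_sq (GaloisClifford.ringChar_ne_two_of_algebra hp)
        (GaloisClifford.trChar_ne_one p hp) hc]
  · rw [GaloisClifford.trace_U_of_lower_unipotent p n F (hone h2 h0) h0, hc]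
    simp
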